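/- **Theorem 3.1.** Let $D$ be a diagram in the plane of a link, with finitely many crossings, each a double crossing or a triple crossing (three strands pass straight through a point, a top strand $T$, a middle strand $M$ and a bottom strand $B$). The Kauffman bracket $\langle D\rangle\in\mathbb Z[A,A^{-1}]$ is the bracket of the diagram obtained by shifting the strands of every triple crossing slightly, so that it resolves into three double crossings. For a diagram $D'$ with only double crossings, $\langle D'\rangle=\sum_s A^{a(s)-b(s)}(-A^2-A^{-2})^{|s|-1}$, where $s$ runs over the states of $D'$ (choices of an $A$- or a $B$-smoothing at each crossing), $a(s)$ and $b(s)$ are the numbers of $A$- and $B$-smoothings in $s$, and $|s|$ is the number of closed curves of $s$; the $A$-smoothing joins the two regions swept out when the overstrand is turned counterclockwise, the $B$-smoothing the other two. Then $\langle D\rangle$ does not depend on the choice of the shifts. Moreover, let $y$ be a triple crossing of $D$. Let $D_M$, $D_B$, $D_T$ be the diagrams obtained from $D$ by splitting $y$ open so that the strand $M$, $B$ or $T$ respectively goes straight through, and the other four ends at $y$ are connected by one U-turn on each side of it; let $D_{U_1}$, $D_{U_2}$ be the two diagrams obtained by connecting the six ends at $y$ by three U-turns, each joining two neighbouring ends.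 If the labels of the strands at $y$, read clockwise, are $B,M,T$ in cyclic order (a BMT crossing), then $$\langle D\rangle=A^{3}\langle D_M\rangle+A\big(\langle D_{U_1}\rangle+\langle D_{U_2}\rangle\big)+A^{-1}\big(\langle D_B\rangle+\langle D_T\rangle\big).$$ If they are $T,M,B$ in cyclic order (a TMB crossing), then $$\langle D\rangle=A^{-3}\langle D_M\rangle+A^{-1}\big(\langle D_{U_1}\rangle+\langle D_{U_2}\rangle\big)+A\big(\langle D_B\rangle+\langle D_T\rangle\big).$$ -/

import Mathlib

/-!
Link diagrams with double and triple crossings, and their Kauffman bracket.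

A diagram is cut into discs, one around each crossing, and the arcs outside the discs.  A disc
around a double crossing meets the link in four ends, a disc around a triple crossing in six ends;
the ends of each disc are numbered in clockwise order, modulo 4 or modulo 6.  The arcs outside the
discs are recorded by the fixed-point-free involution `join` that pairs the ends they connect.
This is the usual planar diagram code, extended to triple crossings.  A six-ended disc may instead
hold three disjoint arcs, which is how the diagrams obtained by splitting open a triple crossing
are drawn.  That the outside arcs can be drawn disjointly in the plane is not required: all
diagrams in the plane are covered, and virtual diagrams are allowed too.
-/

namespace TripleCrossing

/-- The strand through the centre of a six-ended disc that the end `i` belongs to: the ends `i` and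
`i + 3` are opposite. -/
def strandOf (i : Fin 6) : Fin 3 := ⟨i.val % 3, Nat.mod_lt _ (by decide)⟩

/-- The five ways to connect six points on a circle by disjoint arcs in the disc:
`straight s`, where the strand `s` goes straight through and the other four ends are connected by a
U-turn on either side of it, and `uturns b`, where neighbouring ends are connected by three
U-turns. -/
inductive Split where
  | straight (s : Fin 3)
  | uturns (b : Fin 2)

/-- The end that is connected to the end `i` inside a split disc. -/
def Split.mate : Split → Fin 6 → Fin 6
  | .straight s, i =>
      if strandOf i = s then i + 3 else if strandOf i = s + 1 then i + 1 else i - 1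
  | .uturns b, i => if i.val % 2 = b.val then i + 1 else i - 1

/-- What a six-ended disc holds: a triple crossing, in which the strand `s` runs at height
`height s` (a bijection; the heights are `0` for the bottom strand B, `1` for the middle strand M,
`2` for the top strand T), or three disjoint arcs. -/
inductive Content where
  | triple (height : Equiv.Perm (Fin 3))
  | split (m : Split)

def Content.isTriple : Content → Bool
  | .triple _ => true
  | .split _ => false

/-- The heights of the strands of a triple crossing. -/
def Content.height : (c : Content) → c.isTriple = true → Equiv.Perm (Fin 3)
  | .triple h, _ => h

/-- The labels of the ends of a triple crossing, read clockwise, are B, M, T, B, M, T up to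
rotation (addition in `Fin 3` is modulo 3). -/
def IsBMT (height : Equiv.Perm (Fin 3)) : Prop :=
  ∀ i : Fin 6, height (strandOf (i + 1)) = height (strandOf i) + 1

/-- The labels of the ends of a triple crossing, read clockwise, are T, M, B, T, M, B up to
rotation. -/
def IsTMB (height : Equiv.Perm (Fin 3)) : Prop :=
  ∀ i : Fin 6, height (strandOf (i + 1)) = height (strandOf i) - 1

/-- The M-split of a triple crossing: the middle strand goes straight through. -/
def splitM (height : Equiv.Perm (Fin 3)) : Split := .straight (height.symm 1)

/-- The B-split of a triple crossing: the bottom strand goes straight through. -/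
def splitB (height : Equiv.Perm (Fin 3)) : Split := .straight (height.symm 0)

/-- The T-split of a triple crossing: the top strand goes straight through. -/
def splitT (height : Equiv.Perm (Fin 3)) : Split := .straight (height.symm 2)

/-- A diagram with double crossings indexed by `X` and six-ended discs indexed by `Y`, holding
elements of `F` (either `Content`, or `Split` if there are no triple crossings).  At the double
crossing `x` the strand with the ends `overEnd x` and `overEnd x + 2` is the overstrand.  `circles` is
the number of closed curves that meet no disc. -/
structure Diagram (X Y F : Type*) where
  overEnd : X → Fin 2
  fill : Y → F
  join : (X × Fin 4) ⊕ (Y × Fin 6) → (X × Fin 4) ⊕ (Y × Fin 6)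
  join_join : ∀ e, join (join e) = e
  join_ne : ∀ e, join e ≠ e
  circles : ℕ

/-- The end that is connected to the end `i` after smoothing a double crossing whose overstrand has
the ends `o` and `o + 2`.  The A-smoothing (`s = true`) opens the channel between the two regions
swept out by turning the overstrand counterclockwise, so it connects each end of the overstrand to
the next end in clockwise order; the B-smoothing (`s = false`) is the other one. -/
def smooth (o : Fin 2) (s : Bool) (i : Fin 4) : Fin 4 :=
  if (i.val % 2 = o.val ↔ s = true) then i + 1 else i - 1

namespace Diagram

variable {X Y : Type*}

/-- The end that is connected to a given end inside its disc, after the double crossings of a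
diagram without triple crossings have been smoothed according to the state `s`. -/
def inside (D : Diagram X Y Split) (s : X → Bool) :
    (X × Fin 4) ⊕ (Y × Fin 6) → (X × Fin 4) ⊕ (Y × Fin 6)
  | .inl (x, i) => .inl (x, smooth (D.overEnd x) (s x) i)
  | .inr (y, i) => .inr (y, (D.fill y).mate i)

/-- The number of closed curves in the state `s`: `Quot` forms the classes of the equivalence
relation generated by being connected by an arc. -/
noncomputable def stateCircles (D : Diagram X Y Split) (s : X → Bool) : ℕ :=
  Nat.card (Quot fun e f => f = D.join e ∨ f = D.inside s e) + D.circles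

/-- The Kauffman bracket in `ℤ[A, A⁻¹]` of a diagram without triple crossings: the sum over the
states `s` of `A ^ (a(s) - b(s)) * (- A ^ 2 - A ^ (-2)) ^ (|s| - 1)`, where `a(s)` and `b(s)` are
the numbers of A- and B-smoothings of `s` and `|s|` is its number of closed curves, which is
positive unless the diagram is empty. -/
noncomputable def stateSum [Fintype X] [DecidableEq X] (D : Diagram X Y Split) :
    LaurentPolynomial ℤ :=
  ∑ s : X → Bool, LaurentPolynomial.T (∑ x, if s x = true then 1 else -1) *
    (-LaurentPolynomial.T 2 - LaurentPolynomial.T (-2)) ^ (D.stateCircles s - 1)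

/-- The triple crossings of a diagram. -/
abbrev Triples (D : Diagram X Y Content) : Type _ := {y : Y // (D.fill y).isTriple = true}

/-- The six-ended discs of a diagram that hold disjoint arcs. -/
abbrev Splits (D : Diagram X Y Content) : Type _ := {y : Y // (D.fill y).isTriple = false}

/-!
Resolving a triple crossing.  If the three strands are shifted slightly into general position, they
form a small triangle, and there are two possibilities, according to the parity `r` of the ends `i`
for which the strands of the ends `i` and `i + 1` cross next to the boundary of the disc.  The three
double crossings are numbered by `c : Fin 3`; the crossing `c` is the one next to the ends
`2 * c + r` and `2 * c + r + 1`.  Its own ends `0`, `1`, `2`, `3`, in clockwise order, are: the one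
towards the boundary end `2 * c + r`, the one towards the boundary end `2 * c + r + 1`, and the
opposite ends of these two.  Following the strand from its end `2`, one arrives at the end `3` of
the crossing `c + 1`, and leaves the disc through `2 * c + r + 3`.
-/

/-- The boundary end `2 * c + r + k` (modulo 6) of a six-ended disc. -/
def boundaryEnd (r : Fin 2) (c : Fin 3) (k : Fin 2) : Fin 6 :=
  ⟨(2 * c.val + r.val + k.val) % 6, Nat.mod_lt _ (by decide)⟩

/-- The crossing next to the boundary end `i`. -/
def nearCrossing (r : Fin 2) (i : Fin 6) : Fin 3 :=
  ⟨(i.val + 6 - r.val) % 6 / 2, by omega⟩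

/-- The end of that crossing, `0` or `1`, which leads to the boundary end `i`. -/
def nearEnd (r : Fin 2) (i : Fin 6) : Fin 4 :=
  ⟨(i.val + 6 - r.val) % 2, by omega⟩

/-- The overstrand of the crossing `c` of a resolved triple crossing: the higher one of the strands
that meet there. -/
def resolvedOver (height : Equiv.Perm (Fin 3)) (r : Fin 2) (c : Fin 3) : Fin 2 :=
  if height (strandOf (boundaryEnd r c 1)) < height (strandOf (boundaryEnd r c 0)) then 0 else 1

/-- The end of the resolved diagram that corresponds to an end of the original one. -/
def resolvedEnd (D : Diagram X Y Content) (ρ : Y → Fin 2) : (X × Fin 4) ⊕ (Y × Fin 6) →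
    ((X ⊕ D.Triples × Fin 3) × Fin 4) ⊕ (D.Splits × Fin 6)
  | .inl (x, i) => .inl (.inl x, i)
  | .inr (y, i) =>
      if h : (D.fill y).isTriple = true then
        .inl (.inr (⟨y, h⟩, nearCrossing (ρ y) i), nearEnd (ρ y) i)
      else .inr (⟨y, Bool.eq_false_of_not_eq_true h⟩, i)

/-- The arcs of the resolved diagram: those of the original one, and for each triple crossing the
three sides of the small triangle. -/
def resolvedJoin (D : Diagram X Y Content) (ρ : Y → Fin 2) :
    ((X ⊕ D.Triples × Fin 3) × Fin 4) ⊕ (D.Splits × Fin 6) →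
    ((X ⊕ D.Triples × Fin 3) × Fin 4) ⊕ (D.Splits × Fin 6)
  | .inl (.inl x, i) => D.resolvedEnd ρ (D.join (.inl (x, i)))
  | .inl (.inr (y, c), 0) => D.resolvedEnd ρ (D.join (.inr (y.1, boundaryEnd (ρ y.1) c 0)))
  | .inl (.inr (y, c), 1) => D.resolvedEnd ρ (D.join (.inr (y.1, boundaryEnd (ρ y.1) c 1)))
  | .inl (.inr (y, c), 2) => .inl (.inr (y, c + 1), 3)
  | .inl (.inr (y, c), 3) => .inl (.inr (y, c - 1), 2)
  | .inr (y, i) => D.resolvedEnd ρ (D.join (.inr (y.1, i)))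

theorem near_cases (r : Fin 2) (i : Fin 6) :
    (nearEnd r i = 0 ∧ boundaryEnd r (nearCrossing r i) 0 = i) ∨
      (nearEnd r i = 1 ∧ boundaryEnd r (nearCrossing r i) 1 = i) := by
  revert r i; decide

theorem near_boundaryEnd (r : Fin 2) (c : Fin 3) :
    nearCrossing r (boundaryEnd r c 0) = c ∧ nearEnd r (boundaryEnd r c 0) = 0 ∧
      nearCrossing r (boundaryEnd r c 1) = c ∧ nearEnd r (boundaryEnd r c 1) = 1 := by
  revert r c; decide

theorem resolvedJoin_resolvedEnd (D : Diagram X Y Content) (ρ : Y → Fin 2)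
    (e : (X × Fin 4) ⊕ (Y × Fin 6)) :
    D.resolvedJoin ρ (D.resolvedEnd ρ e) = D.resolvedEnd ρ (D.join e) := by
  rcases e with ⟨x, i⟩ | ⟨y, i⟩
  · simp [resolvedEnd, resolvedJoin]
  · by_cases h : (D.fill y).isTriple = true
    · rcases near_cases (ρ y) i with ⟨h1, h2⟩ | ⟨h1, h2⟩ <;>
        · have : D.resolvedEnd ρ (.inr (y, i)) =
              .inl (.inr (⟨y, h⟩, nearCrossing (ρ y) i), nearEnd (ρ y) i) := by
            simp [resolvedEnd, h]
          rw [this, h1]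
          simp [resolvedJoin, h2]
    · have : D.resolvedEnd ρ (.inr (y, i)) =
          .inr (⟨y, Bool.eq_false_of_not_eq_true h⟩, i) := by
        simp [resolvedEnd, h]
      rw [this]
      simp [resolvedJoin]

theorem resolvedEnd_injective (D : Diagram X Y Content) (ρ : Y → Fin 2) :
    Function.Injective (D.resolvedEnd ρ) := by
  have key : ∀ (r : Fin 2) (i j : Fin 6), nearCrossing r i = nearCrossing r j →
      nearEnd r i = nearEnd r j → i = j := by decide
  rintro (⟨x, i⟩ | ⟨y, i⟩) (⟨x', i'⟩ | ⟨y', i'⟩) h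
  · simpa [resolvedEnd] using h
  · by_cases h' : (D.fill y').isTriple = true <;> simp [resolvedEnd, h'] at h
  · by_cases h' : (D.fill y).isTriple = true <;> simp [resolvedEnd, h'] at h
  · by_cases h1 : (D.fill y).isTriple = true <;> by_cases h2 : (D.fill y').isTriple = true <;>
      simp [resolvedEnd, h1, h2] at h
    · obtain ⟨⟨rfl, h3⟩, h4⟩ := h
      rw [key _ _ _ h3 h4]
    · obtain ⟨rfl, rfl⟩ := h
      rfl

/-- The cases of an end of the resolved diagram: either it is an end of the original diagram, or
one end of a side of a small triangle. -/
theorem resolved_cases (D : Diagram X Y Content) (ρ : Y → Fin 2)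
    (e : ((X ⊕ D.Triples × Fin 3) × Fin 4) ⊕ (D.Splits × Fin 6)) :
    (∃ e', e = D.resolvedEnd ρ e') ∨
      ∃ y c, e = .inl (.inr (y, c), 2) ∨ e = .inl (.inr (y, c), 3) := by
  rcases e with ⟨x | ⟨y, c⟩, i⟩ | ⟨y, i⟩
  · exact .inl ⟨.inl (x, i), rfl⟩
  · obtain ⟨n1, n2, n3, n4⟩ := near_boundaryEnd (ρ y.1) c
    fin_cases i
    · exact .inl ⟨.inr (y.1, boundaryEnd (ρ y.1) c 0), by simp [resolvedEnd, y.2, n1, n2]⟩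
    · exact .inl ⟨.inr (y.1, boundaryEnd (ρ y.1) c 1), by simp [resolvedEnd, y.2, n3, n4]⟩
    · exact .inr ⟨y, c, .inl rfl⟩
    · exact .inr ⟨y, c, .inr rfl⟩
  · exact .inl ⟨.inr (y.1, i), by simp [resolvedEnd, y.2]⟩

/-- The diagram in which every triple crossing is resolved into three double crossings, in the way
chosen by `ρ`. -/
def resolve (D : Diagram X Y Content) (ρ : Y → Fin 2) :
    Diagram (X ⊕ D.Triples × Fin 3) D.Splits Split where
  overEnd
    | .inl x => D.overEnd x
    | .inr (y, c) => resolvedOver ((D.fill y.1).height y.2) (ρ y.1) c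
  fill y :=
    match D.fill y.1, y.2 with
    | .split m, _ => m
  join := D.resolvedJoin ρ
  join_join e := by
    rcases D.resolved_cases ρ e with ⟨e', rfl⟩ | ⟨y, c, rfl | rfl⟩
    · rw [resolvedJoin_resolvedEnd, resolvedJoin_resolvedEnd, D.join_join]
    · simp [resolvedJoin]
    · simp [resolvedJoin]
  join_ne e := by
    rcases D.resolved_cases ρ e with ⟨e', rfl⟩ | ⟨y, c, rfl | rfl⟩
    · rw [resolvedJoin_resolvedEnd]
      exact fun h => D.join_ne e' (D.resolvedEnd_injective ρ h)
    · simp [resolvedJoin]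
    · simp [resolvedJoin]
  circles := D.circles

/-- The Kauffman bracket of a diagram with double and triple crossings: the bracket of the diagram
in which the triple crossings are resolved into double crossings, in the way chosen by `ρ`. -/
noncomputable def bracket [Fintype X] [DecidableEq X] [Fintype Y] [DecidableEq Y]
    (D : Diagram X Y Content) (ρ : Y → Fin 2) : LaurentPolynomial ℤ :=
  (D.resolve ρ).stateSum

/-- The diagram that agrees with `D` outside the six-ended disc `y`, where it is split open
according to `m`. -/
def splitAt [DecidableEq Y] (D : Diagram X Y Content) (y : Y) (m : Split) :
    Diagram X Y Content where
  overEnd := D.overEnd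
  fill := Function.update D.fill y (.split m)
  join := D.join
  join_join := D.join_join
  join_ne := D.join_ne
  circles := D.circles

end Diagram

end TripleCrossing

namespace TripleCrossing

open Diagram

/-! The bracket is multilinear in the contents of the six-ended discs, so both claims reduce to one
finite computation inside a disc. Each of the eight smoothings of a resolved triple crossing joins
the six boundary ends by one of the five splits and adds at most one closed curve, the small
triangle. Collecting powers of `A`, and a factor `loopValue` for the triangle, gives each split a
coefficient, `crossingsCoeff`. Then `bracket_eq_sum` writes the bracket as a sum over the states of
the original double crossings and one split per disc, weighted by the product of these coefficients.
Its topological input is `curvesEquiv`: the curves of a resolved state are those of the diagram with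
arcs in the discs, together with the triangles.

In the local computation, four smoothings give `uturns r`. The one with the triangle has some
exponent `a` and contributes -A^(a+2) - A^(a-2). The other three differ from it at one crossing, so
their exponents are a+2 or a-2. Both values occur, since heights cannot rise, or fall, all the way
round the triangle. Hence two of the three cancel, and five terms survive, one for each split: the
right side of the skein relation. They do not depend on the resolution `r`, which gives invariance
under the choice of shifts. -/

def splitEquiv : Fin 3 ⊕ Fin 2 ≃ Split where
  toFun := Sum.elim .straight .uturns
  invFun
    | .straight s => .inl s
    | .uturns b => .inr b
  left_inv := by rintro (s | b) <;> rfl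
  right_inv := by rintro (s | b) <;> rfl

instance : Fintype Split := Fintype.ofEquiv _ splitEquiv

instance : DecidableEq Split := splitEquiv.symm.decidableEq

/-! Curves inside a resolved triple crossing.  The smoothings of its three crossings are described
by `p : Fin 3 → Bool`, where `p c` is true if the ends `0` and `1` of the crossing `c` are
connected. -/

/-- The end connected to an end of the three crossings by their smoothings. -/
def localInside (p : Fin 3 → Bool) (e : Fin 3 × Fin 4) : Fin 3 × Fin 4 :=
  (e.1, smooth 0 (p e.1) e.2)

/-- The other end of the side of the small triangle at an end; ends towards the boundary of the
disc are fixed. -/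
def localSide : Fin 3 × Fin 4 → Fin 3 × Fin 4
  | (c, 2) => (c + 1, 3)
  | (c, 3) => (c - 1, 2)
  | e => e

/-- The end of the three crossings that leads to the boundary end `i`. -/
def near (r : Fin 2) (i : Fin 6) : Fin 3 × Fin 4 := (nearCrossing r i, nearEnd r i)

/-- One side of the triangle and then one smoothing arc; iterating it follows a curve in a fixed
direction. A start at the boundary uses only the smoothing arc. -/
def localStep (p : Fin 3 → Bool) (e : Fin 3 × Fin 4) : Fin 3 × Fin 4 := localInside p (localSide e)

/-- The boundary end that is reached within `n` steps. -/
def exitWithin (r : Fin 2) (p : Fin 3 → Bool) : ℕ → Fin 3 × Fin 4 → Option (Fin 6)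
  | 0, (c, i) =>
      if i = 0 then some (boundaryEnd r c 0) else if i = 1 then some (boundaryEnd r c 1) else none
  | n + 1, (c, i) =>
      if i = 0 then some (boundaryEnd r c 0) else if i = 1 then some (boundaryEnd r c 1) else
        exitWithin r p n (localStep p (c, i))

/-- The boundary end that the curve through an end of the three crossings leads to, if it is not
closed. -/
def exit (r : Fin 2) (p : Fin 3 → Bool) : Fin 3 × Fin 4 → Option (Fin 6) := exitWithin r p 3

/-- The arcs that connect the boundary ends. -/
def localSplit (r : Fin 2) (p : Fin 3 → Bool) : Split :=
  if p 0 then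
    if p 1 || p 2 then .uturns r else .straight (strandOf (boundaryEnd r 0 1 + 1))
  else if p 1 then
    if p 2 then .uturns r else .straight (strandOf (boundaryEnd r 1 1 + 1))
  else if p 2 then .straight (strandOf (boundaryEnd r 2 1 + 1)) else .uturns (r + 1)

/-- Whether there is a closed curve inside the disc. -/
def hasLoop (p : Fin 3 → Bool) : Bool := p 0 && p 1 && p 2

/-! ### Finite checks on the eight smoothings of a resolved triple crossing. -/

set_option maxRecDepth 100000

/-- `exit` depends on the direction of travel, and the two ends of an arc may lead opposite ways.
The two exits of a curve that is not closed are mates in the split, so the curve itself is well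
defined. -/
theorem exit_localInside (r : Fin 2) (p : Fin 3 → Bool) (e : Fin 3 × Fin 4) :
    exit r p (localInside p e) = exit r p e ∨
      exit r p (localInside p e) = (exit r p e).map (localSplit r p).mate := by
  revert r p e; decide

theorem exit_localSide (r : Fin 2) (p : Fin 3 → Bool) (e : Fin 3 × Fin 4) :
    exit r p (localSide e) = exit r p e ∨
      exit r p (localSide e) = (exit r p e).map (localSplit r p).mate := by
  revert r p e; decide

theorem exit_near (r : Fin 2) (p : Fin 3 → Bool) (i : Fin 6) : exit r p (near r i) = some i := by
  revert r p i; decide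

theorem hasLoop_of_exit_eq_none (r : Fin 2) (p : Fin 3 → Bool) (e : Fin 3 × Fin 4)
    (h : exit r p e = none) : hasLoop p = true := by
  revert r p e; decide

theorem exit_eq_none_of_hasLoop (r : Fin 2) (p : Fin 3 → Bool) (h : hasLoop p = true) :
    exit r p (0, 2) = none := by
  revert r p; decide

/-- This justifies `localSplit`: each of its arcs is traced by a path through the three crossings.
The bound on `n` makes the claim decidable. -/
theorem exists_iterate_near (r : Fin 2) (p : Fin 3 → Bool) (i : Fin 6) :
    ∃ n : Fin 5, (localStep p)^[n] (near r i) = near r ((localSplit r p).mate i) := by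
  revert r p i; decide

theorem exists_iterate_of_exit_eq_some (r : Fin 2) (p : Fin 3 → Bool) (e : Fin 3 × Fin 4)
    (i : Fin 6) (h : exit r p e = some i) : ∃ n : Fin 4, (localStep p)^[n] e = near r i := by
  revert r p e i; decide

/-- In one direction the steps round the triangle visit only the ends `2`, in the other only the
ends `3`; hence two possible targets, the two ends of one side. -/
theorem exists_iterate_of_exit_eq_none (r : Fin 2) (p : Fin 3 → Bool) (e : Fin 3 × Fin 4)
    (h : exit r p e = none) :
    ∃ n : Fin 4, (localStep p)^[n] e = (0, 2) ∨ (localStep p)^[n] e = localSide (0, 2) := by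
  revert r p e; decide

/-- Exchanging over and under exchanges the A- and the B-smoothing, so the arcs depend only on one
Boolean. -/
theorem smooth_eq (o : Fin 2) (s : Bool) (i : Fin 4) :
    smooth o s i = smooth 0 (decide (o = 0 ↔ s = true)) i := by
  revert o s i; decide

/-! The contribution of a six-ended disc to the bracket. -/

/-- The value of a closed curve. -/
noncomputable def loopValue : LaurentPolynomial ℤ :=
  -LaurentPolynomial.T 2 - LaurentPolynomial.T (-2)

/-- The smoothings of the three crossings, in the description used by `localSplit`. -/
def connects (o : Fin 3 → Fin 2) (k : Fin 3 → Bool) (c : Fin 3) : Bool :=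
  decide (o c = 0 ↔ k c = true)

/-- The coefficient of the split `m` in the expansion of three crossings with overstrands `o`. -/
noncomputable def crossingsCoeff (r : Fin 2) (o : Fin 3 → Fin 2) (m : Split) :
    LaurentPolynomial ℤ :=
  ∑ k : Fin 3 → Bool, if localSplit r (connects o k) = m then
    LaurentPolynomial.T (∑ c, if k c = true then 1 else -1) *
      (if hasLoop (connects o k) = true then loopValue else 1) else 0

/-! ### The local skein identity, reduced to multisets of exponents. -/

theorem isBMT_or_isTMB (h : Equiv.Perm (Fin 3)) : IsBMT h ∨ IsTMB h := by
  revert h; unfold IsBMT IsTMB; decide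

/-- The right side of the skein relation, with `q = 1` at a BMT crossing and `q = -1` at a TMB
crossing, as a function of the splits. -/
noncomputable def skeinCoeff (q : ℤ) (h : Equiv.Perm (Fin 3)) (m : Split) : LaurentPolynomial ℤ :=
  LaurentPolynomial.T (3 * q) * (if splitM h = m then 1 else 0) +
    LaurentPolynomial.T q * ((if .uturns 0 = m then 1 else 0) + if .uturns 1 = m then 1 else 0) +
    LaurentPolynomial.T (-q) * ((if splitB h = m then 1 else 0) + if splitT h = m then 1 else 0)

/-- The exponents of the terms without closed curve in `crossingsCoeff`. -/
def posExponents (r : Fin 2) (o : Fin 3 → Fin 2) (m : Split) : Multiset ℤ :=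
  ∑ k : Fin 3 → Bool, if localSplit r (connects o k) = m then
    if hasLoop (connects o k) = true then 0 else {∑ c, if k c = true then 1 else -1} else 0

/-- The exponents of the terms with a closed curve in `crossingsCoeff`. -/
def negExponents (r : Fin 2) (o : Fin 3 → Fin 2) (m : Split) : Multiset ℤ :=
  ∑ k : Fin 3 → Bool, if localSplit r (connects o k) = m then
    if hasLoop (connects o k) = true then
      {(∑ c, if k c = true then 1 else -1) + 2, (∑ c, if k c = true then 1 else -1) - 2}
    else 0 else 0

/-- The exponents in `skeinCoeff`. -/
def skeinExponents (q : ℤ) (h : Equiv.Perm (Fin 3)) (m : Split) : Multiset ℤ :=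
  (if splitM h = m then {3 * q} else 0) +
    ((if .uturns 0 = m then {q} else 0) + if .uturns 1 = m then {q} else 0) +
    ((if splitB h = m then {-q} else 0) + if splitT h = m then {-q} else 0)

/-- The sum of the powers with given exponents. -/
noncomputable def sumPowers : Multiset ℤ →+ LaurentPolynomial ℤ :=
  Multiset.sumAddMonoidHom.comp (Multiset.mapAddMonoidHom LaurentPolynomial.T)

theorem sumPowers_singleton (n : ℤ) : sumPowers {n} = LaurentPolynomial.T n := by
  simp [sumPowers]

/-- All monomials have coefficient 1 or -1, the negative ones coming from `loopValue`. Identities of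
Laurent polynomials thus follow from identities of finite multisets of integers, which can be
decided. -/
theorem crossingsCoeff_eq (r : Fin 2) (o : Fin 3 → Fin 2) (m : Split) :
    crossingsCoeff r o m = sumPowers (posExponents r o m) - sumPowers (negExponents r o m) := by
  rw [crossingsCoeff, posExponents, negExponents, map_sum, map_sum, ← Finset.sum_sub_distrib]
  refine Finset.sum_congr rfl fun k _ => ?_
  split_ifs
  · rw [Multiset.insert_eq_cons, ← Multiset.singleton_add, map_add, sumPowers_singleton,
      sumPowers_singleton, map_zero, loopValue, sub_eq_add_neg _ (2 : ℤ), LaurentPolynomial.T_add,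
      LaurentPolynomial.T_add]
    ring
  · rw [sumPowers_singleton, map_zero, mul_one, sub_zero]
  · simp

theorem skeinCoeff_eq (q : ℤ) (h : Equiv.Perm (Fin 3)) (m : Split) :
    skeinCoeff q h m = sumPowers (skeinExponents q h m) := by
  simp only [skeinCoeff, skeinExponents, map_add, apply_ite sumPowers, sumPowers_singleton,
    map_zero, mul_add, mul_ite, mul_one, mul_zero]

/-- The cancellation of the triangle term, with the negative terms moved to the right to avoid
subtraction of multisets. -/
theorem posExponents_of_isBMT (r : Fin 2) {h : Equiv.Perm (Fin 3)} (hh : IsBMT h) (m : Split) :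
    posExponents r (resolvedOver h r) m =
      skeinExponents 1 h m + negExponents r (resolvedOver h r) m := by
  revert r h m; unfold IsBMT; decide +kernel

theorem posExponents_of_isTMB (r : Fin 2) {h : Equiv.Perm (Fin 3)} (hh : IsTMB h) (m : Split) :
    posExponents r (resolvedOver h r) m =
      skeinExponents (-1) h m + negExponents r (resolvedOver h r) m := by
  revert r h m; unfold IsTMB; decide +kernel

theorem crossingsCoeff_of_isBMT (r : Fin 2) {h : Equiv.Perm (Fin 3)} (hh : IsBMT h) (m : Split) :
    crossingsCoeff r (resolvedOver h r) m = skeinCoeff 1 h m := by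
  rw [crossingsCoeff_eq, posExponents_of_isBMT r hh, map_add, add_sub_cancel_right, skeinCoeff_eq]

theorem crossingsCoeff_of_isTMB (r : Fin 2) {h : Equiv.Perm (Fin 3)} (hh : IsTMB h) (m : Split) :
    crossingsCoeff r (resolvedOver h r) m = skeinCoeff (-1) h m := by
  rw [crossingsCoeff_eq, posExponents_of_isTMB r hh, map_add, add_sub_cancel_right, skeinCoeff_eq]

/-! ### Curves of a resolved state against curves of the diagram with arcs in its discs. -/

namespace Diagram

variable {X Y : Type*}

/-- The diagram that agrees with `D` outside the six-ended discs, which hold the arcs `m`. -/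
def withFill {F G : Type*} (D : Diagram X Y F) (m : Y → G) : Diagram X Y G where
  overEnd := D.overEnd
  fill := m
  join := D.join
  join_join := D.join_join
  join_ne := D.join_ne
  circles := D.circles

/-- The diagrams obtained from `D` by replacing each resolved triple crossing by arcs, according to
the smoothings `k` of its crossings. -/
def localFill (D : Diagram X Y Content) (ρ : Y → Fin 2) (k : D.Triples × Fin 3 → Bool) (y : Y) :
    Split :=
  if h : (D.fill y).isTriple = true then
    localSplit (ρ y) (connects (resolvedOver ((D.fill y).height h) (ρ y)) fun c => k (⟨y, h⟩, c))
  else (D.resolve ρ).fill ⟨y, Bool.eq_false_of_not_eq_true h⟩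

section Curves

variable (D : Diagram X Y Content) (ρ : Y → Fin 2) (s : X ⊕ D.Triples × Fin 3 → Bool)

/-- The smoothings at a triple crossing, in the description used by `localSplit`. -/
def smoothings (y : D.Triples) : Fin 3 → Bool :=
  connects (resolvedOver ((D.fill y.1).height y.2) (ρ y.1)) fun c => s (.inr (y, c))

/-- The closed curves of a state that meet a disc. -/
abbrev Curves {X Y : Type*} (D : Diagram X Y Split) (s : X → Bool) : Type _ :=
  Quot fun e f => f = D.join e ∨ f = D.inside s e

variable {D ρ s}

theorem Curves.mk_join {X Y : Type*} {D : Diagram X Y Split} {s : X → Bool}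
    (e : (X × Fin 4) ⊕ (Y × Fin 6)) :
    (Quot.mk _ (D.join e) : D.Curves s) = Quot.mk _ e :=
  (Quot.sound (.inl rfl)).symm

theorem Curves.mk_inside {X Y : Type*} {D : Diagram X Y Split} {s : X → Bool}
    (e : (X × Fin 4) ⊕ (Y × Fin 6)) :
    (Quot.mk _ (D.inside s e) : D.Curves s) = Quot.mk _ e :=
  (Quot.sound (.inr rfl)).symm

variable (D ρ s)

/-- An end of a crossing of a resolved triple crossing, as an end of the resolved diagram. -/
def tripleEnd (y : D.Triples) (e : Fin 3 × Fin 4) :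
    ((X ⊕ D.Triples × Fin 3) × Fin 4) ⊕ (D.Splits × Fin 6) :=
  .inl (.inr (y, e.1), e.2)

/-- The curve through an end of a crossing of a resolved triple crossing. -/
def tripleCurve (y : D.Triples) (e : Fin 3 × Fin 4) : (D.resolve ρ).Curves s :=
  Quot.mk _ (D.tripleEnd y e)

/-- The diagram in which the resolved triple crossings are replaced by arcs. -/
abbrev smoothed : Diagram X Y Split := D.withFill (D.localFill ρ fun z => s (.inr z))

/-- The triple crossings with a closed curve inside. -/
abbrev Loops : Type _ := {y : D.Triples // hasLoop (D.smoothings ρ s y) = true}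

variable {D ρ s}

theorem localFill_triple (y : D.Triples) :
    D.localFill ρ (fun z => s (.inr z)) y.1 = localSplit (ρ y.1) (D.smoothings ρ s y) := by
  rw [localFill, dif_pos y.2]; rfl

theorem tripleEnd_near (y : D.Triples) (i : Fin 6) :
    D.tripleEnd y (near (ρ y.1) i) = D.resolvedEnd ρ (.inr (y.1, i)) := by
  simp [tripleEnd, near, resolvedEnd, y.2]

theorem inside_tripleEnd (y : D.Triples) (e : Fin 3 × Fin 4) :
    (D.resolve ρ).inside s (D.tripleEnd y e) =
      D.tripleEnd y (localInside (D.smoothings ρ s y) e) := by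
  simp only [tripleEnd, inside, localInside]
  rw [smooth_eq]
  rfl

theorem join_tripleEnd (y : D.Triples) (e : Fin 3 × Fin 4) :
    (D.resolve ρ).join (D.tripleEnd y e) = D.tripleEnd y (localSide e) ∨
      localSide e = e := by
  obtain ⟨c, i⟩ := e
  fin_cases i
  · exact .inr rfl
  · exact .inr rfl
  · exact .inl rfl
  · exact .inl rfl

theorem tripleCurve_localInside (y : D.Triples) (e : Fin 3 × Fin 4) :
    D.tripleCurve ρ s y (localInside (D.smoothings ρ s y) e) = D.tripleCurve ρ s y e := by
  rw [tripleCurve, ← inside_tripleEnd, Curves.mk_inside]; rfl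

theorem tripleCurve_localSide (y : D.Triples) (e : Fin 3 × Fin 4) :
    D.tripleCurve ρ s y (localSide e) = D.tripleCurve ρ s y e := by
  rcases join_tripleEnd (ρ := ρ) y e with h | h
  · rw [tripleCurve, ← h, Curves.mk_join]; rfl
  · rw [h]

theorem tripleCurve_iterate (y : D.Triples) (n : ℕ) (e : Fin 3 × Fin 4) :
    D.tripleCurve ρ s y ((localStep (D.smoothings ρ s y))^[n] e) = D.tripleCurve ρ s y e := by
  induction n generalizing e with
  | zero => rfl
  | succ n ih =>
    rw [Function.iterate_succ_apply, ih, localStep, tripleCurve_localInside, tripleCurve_localSide]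

theorem tripleCurve_near (y : D.Triples) (i : Fin 6) :
    D.tripleCurve ρ s y (near (ρ y.1) i) = Quot.mk _ (D.resolvedEnd ρ (.inr (y.1, i))) := by
  rw [tripleCurve, tripleEnd_near]

variable (D ρ s) in
/-- The curve through an end of the smoothed diagram, or the loop, that an end of a resolved triple
crossing belongs to. -/
def exitCurve (y : D.Triples) (e : Fin 3 × Fin 4) :
    (D.smoothed ρ s).Curves (fun x => s (.inl x)) ⊕ D.Loops ρ s :=
  match h : exit (ρ y.1) (D.smoothings ρ s y) e with
  | some i => .inl (Quot.mk _ (.inr (y.1, i)))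
  | none => .inr ⟨y, hasLoop_of_exit_eq_none _ _ _ h⟩

theorem exitCurve_of_some {y : D.Triples} {e : Fin 3 × Fin 4} {i : Fin 6}
    (h : exit (ρ y.1) (D.smoothings ρ s y) e = some i) :
    D.exitCurve ρ s y e = .inl (Quot.mk _ (.inr (y.1, i))) := by
  unfold exitCurve
  split
  · rename_i j hj
    rw [h] at hj; cases hj; rfl
  · rename_i hj
    rw [h] at hj; cases hj

theorem exitCurve_of_none {y : D.Triples} {e : Fin 3 × Fin 4}
    (h : exit (ρ y.1) (D.smoothings ρ s y) e = none) :
    D.exitCurve ρ s y e = .inr ⟨y, hasLoop_of_exit_eq_none _ _ _ h⟩ := by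
  unfold exitCurve
  split
  · rename_i j hj
    rw [h] at hj; cases hj
  · rfl

theorem exitCurve_congr {y : D.Triples} {e f : Fin 3 × Fin 4}
    (h : exit (ρ y.1) (D.smoothings ρ s y) f = exit (ρ y.1) (D.smoothings ρ s y) e ∨
      exit (ρ y.1) (D.smoothings ρ s y) f = (exit (ρ y.1) (D.smoothings ρ s y) e).map
        (localSplit (ρ y.1) (D.smoothings ρ s y)).mate) :
    D.exitCurve ρ s y f = D.exitCurve ρ s y e := by
  cases he : exit (ρ y.1) (D.smoothings ρ s y) e with
  | none =>
    rw [he, Option.map_none, or_self] at h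
    rw [exitCurve_of_none h, exitCurve_of_none he]
  | some i =>
    rw [he] at h
    rcases h with h | h
    · rw [exitCurve_of_some h, exitCurve_of_some he]
    · rw [Option.map_some] at h
      rw [exitCurve_of_some h, exitCurve_of_some he]
      congr 1
      -- The two exits are joined by an arc of the split, hence lie on one curve of the smoothed
      -- diagram.
      rw [← localFill_triple y]
      exact Curves.mk_inside (D := D.smoothed ρ s) (.inr (y.1, i))

variable (D ρ s) in
/-- The curve through an end of the smoothed diagram, or the loop, that an end of the resolved
diagram belongs to. -/
def curveOf : ((X ⊕ D.Triples × Fin 3) × Fin 4) ⊕ (D.Splits × Fin 6) →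
    (D.smoothed ρ s).Curves (fun x => s (.inl x)) ⊕ D.Loops ρ s
  | .inl (.inl x, i) => .inl (Quot.mk _ (.inl (x, i)))
  | .inl (.inr (y, c), i) => D.exitCurve ρ s y (c, i)
  | .inr (y, i) => .inl (Quot.mk _ (.inr (y.1, i)))

theorem curveOf_resolvedEnd (e : (X × Fin 4) ⊕ (Y × Fin 6)) :
    D.curveOf ρ s (D.resolvedEnd ρ e) = .inl (Quot.mk _ e) := by
  rcases e with ⟨x, i⟩ | ⟨y, i⟩
  · rfl
  · by_cases h : (D.fill y).isTriple = true
    · rw [← tripleEnd_near ⟨y, h⟩]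
      exact exitCurve_of_some (exit_near _ _ _)
    · simp [resolvedEnd, h, curveOf]

theorem curveOf_join (e : ((X ⊕ D.Triples × Fin 3) × Fin 4) ⊕ (D.Splits × Fin 6)) :
    D.curveOf ρ s ((D.resolve ρ).join e) = D.curveOf ρ s e := by
  rcases D.resolved_cases ρ e with ⟨e, rfl⟩ | ⟨y, c, rfl | rfl⟩
  · rw [show (D.resolve ρ).join (D.resolvedEnd ρ e) = D.resolvedEnd ρ (D.join e) from
      D.resolvedJoin_resolvedEnd ρ e, curveOf_resolvedEnd, curveOf_resolvedEnd]
    exact congrArg _ (Curves.mk_join (D := D.smoothed ρ s) e)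
  · exact exitCurve_congr (exit_localSide _ _ (c, 2))
  · exact exitCurve_congr (exit_localSide _ _ (c, 3))

theorem curveOf_inside (e : ((X ⊕ D.Triples × Fin 3) × Fin 4) ⊕ (D.Splits × Fin 6)) :
    D.curveOf ρ s ((D.resolve ρ).inside s e) = D.curveOf ρ s e := by
  rcases e with ⟨x | ⟨y, c⟩, i⟩ | ⟨y, i⟩
  · exact congrArg Sum.inl
      (Curves.mk_inside (D := D.smoothed ρ s) (s := fun x => s (.inl x)) (.inl (x, i)))
  · rw [show (Sum.inl (Sum.inr (y, c), i) : ((X ⊕ D.Triples × Fin 3) × Fin 4) ⊕ (D.Splits × Fin 6))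
      = D.tripleEnd y (c, i) from rfl, inside_tripleEnd]
    exact exitCurve_congr (exit_localInside _ _ (c, i))
  · have h : (D.smoothed ρ s).inside (fun x => s (.inl x)) (.inr (y.1, i)) =
        .inr (y.1, ((D.resolve ρ).fill y).mate i) := by
      simp [inside, withFill, localFill, y.2]
    rw [show D.curveOf ρ s ((D.resolve ρ).inside s (.inr (y, i))) =
      .inl (Quot.mk _ (.inr (y.1, ((D.resolve ρ).fill y).mate i))) from rfl, ← h]
    exact congrArg _ (Curves.mk_inside (D := D.smoothed ρ s) (.inr (y.1, i)))

/-- An arc of the smoothed diagram stands for a path in the resolved one, so the inverse map of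
`curvesEquiv` respects it. -/
theorem mk_resolvedEnd_inside (e : (X × Fin 4) ⊕ (Y × Fin 6)) :
    (Quot.mk _ (D.resolvedEnd ρ ((D.smoothed ρ s).inside (fun x => s (.inl x)) e)) :
      (D.resolve ρ).Curves s) = Quot.mk _ (D.resolvedEnd ρ e) := by
  rcases e with ⟨x, i⟩ | ⟨y, i⟩
  · exact Curves.mk_inside (D := D.resolve ρ) (.inl (.inl x, i))
  · by_cases h : (D.fill y).isTriple = true
    · obtain ⟨n, hn⟩ := exists_iterate_near (ρ y) (D.smoothings ρ s ⟨y, h⟩) i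
      have := tripleCurve_iterate (ρ := ρ) (s := s) ⟨y, h⟩ n (near (ρ y) i)
      rw [hn] at this
      rw [show (D.smoothed ρ s).inside (fun x => s (.inl x)) (.inr (y, i)) =
        .inr (y, (D.localFill ρ (fun z => s (.inr z)) y).mate i) from rfl,
        localFill_triple (s := s) ⟨y, h⟩, ← tripleCurve_near ⟨y, h⟩, ← tripleCurve_near ⟨y, h⟩]
      exact this
    · have := Curves.mk_inside (D := D.resolve ρ) (s := s)
        (.inr (⟨y, Bool.eq_false_of_not_eq_true h⟩, i))
      simpa [resolvedEnd, inside, withFill, localFill, h] using this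

variable (D ρ s) in
/-- Each curve of a state of the resolved diagram is a curve of the smoothed diagram or a loop
inside a triple crossing. -/
def curvesEquiv : (D.resolve ρ).Curves s ≃
    (D.smoothed ρ s).Curves (fun x => s (.inl x)) ⊕ D.Loops ρ s where
  toFun := Quot.lift (D.curveOf ρ s) fun e f h => by
    rcases h with rfl | rfl
    · rw [curveOf_join]
    · rw [curveOf_inside]
  invFun := Sum.elim
    (Quot.lift (fun e => Quot.mk _ (D.resolvedEnd ρ e)) fun e f h => by
      rcases h with rfl | rfl
      · rw [show D.resolvedEnd ρ ((D.smoothed ρ s).join e) =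
          (D.resolve ρ).join (D.resolvedEnd ρ e) from (D.resolvedJoin_resolvedEnd ρ e).symm,
          Curves.mk_join]
      · exact (mk_resolvedEnd_inside e).symm)
    -- With a loop present, every end `2` or `3` lies on it; `(0, 2)` is an arbitrary
    -- representative.
    fun y => D.tripleCurve ρ s y.1 (0, 2)
  left_inv := by
    rintro ⟨e⟩
    rcases e with ⟨x | ⟨y, c⟩, i⟩ | ⟨y, i⟩
    · rfl
    · change Sum.elim _ _ (D.exitCurve ρ s y (c, i)) = D.tripleCurve ρ s y (c, i)
      cases he : exit (ρ y.1) (D.smoothings ρ s y) (c, i) with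
      | none =>
        rw [exitCurve_of_none he, Sum.elim_inr]
        obtain ⟨n, hn | hn⟩ := exists_iterate_of_exit_eq_none _ _ _ he
        · rw [← tripleCurve_iterate y n (c, i), hn]
        · rw [← tripleCurve_iterate y n (c, i), hn, tripleCurve_localSide]
      | some j =>
        obtain ⟨n, hn⟩ := exists_iterate_of_exit_eq_some _ _ _ _ he
        rw [exitCurve_of_some he, Sum.elim_inl, ← tripleCurve_iterate y n (c, i), hn,
          tripleCurve_near]
    · change Quot.mk _ (D.resolvedEnd ρ (.inr (y.1, i))) = Quot.mk _ (.inr (y, i))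
      simp [resolvedEnd, y.2]
  right_inv := by
    rintro (⟨⟨e⟩⟩ | ⟨y, hy⟩)
    · exact curveOf_resolvedEnd e
    · exact exitCurve_of_none (exit_eq_none_of_hasLoop _ _ hy)

theorem stateCircles_resolve [Finite X] [Finite Y] :
    (D.resolve ρ).stateCircles s =
      (D.smoothed ρ s).stateCircles (fun x => s (.inl x)) + Nat.card (D.Loops ρ s) := by
  rw [stateCircles, Nat.card_congr (D.curvesEquiv ρ s), Nat.card_sum, stateCircles]
  exact Nat.add_right_comm _ _ _

end Curves

end Diagram

/-- The coefficient of the split `m` in the expansion of a disc. -/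
noncomputable def contentCoeff (r : Fin 2) : Content → Split → LaurentPolynomial ℤ
  | .triple h, m => crossingsCoeff r (resolvedOver h r) m
  | .split m', m => if m' = m then 1 else 0

/-- Invariance under the third Reidemeister move, in local form: the skein coefficients do not
mention `r`. -/
theorem contentCoeff_eq (r r' : Fin 2) (c : Content) (m : Split) :
    contentCoeff r c m = contentCoeff r' c m := by
  cases c with
  | split => rfl
  | triple h =>
    rcases isBMT_or_isTMB h with hh | hh
    · simp only [contentCoeff, crossingsCoeff_of_isBMT _ hh]
    · simp only [contentCoeff, crossingsCoeff_of_isTMB _ hh]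

theorem contentCoeff_of_isTriple (r : Fin 2) (c : Content) (hc : c.isTriple = true) (m : Split) :
    contentCoeff r c m = crossingsCoeff r (resolvedOver (c.height hc) r) m := by
  cases c with
  | triple h => rfl
  | split => cases hc

open Classical in
theorem contentCoeff_of_not_isTriple (r : Fin 2) (c : Content) (hc : ¬ c.isTriple = true)
    (m : Split) : contentCoeff r c m = if c = .split m then 1 else 0 := by
  cases c with
  | triple => exact absurd rfl hc
  | split => simp only [contentCoeff, Content.split.injEq]

/-! ### Expansion of the bracket over the splits of all discs. -/

namespace Diagram

variable {X Y : Type*}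

theorem localFill_eq_iff (D : Diagram X Y Content) (ρ : Y → Fin 2) (k : D.Triples × Fin 3 → Bool)
    (m : Y → Split) :
    D.localFill ρ k = m ↔
      (∀ y : D.Triples, localSplit (ρ y.1)
        (connects (resolvedOver ((D.fill y.1).height y.2) (ρ y.1)) fun c => k (y, c)) = m y.1) ∧
      ∀ y : {y : Y // ¬ (D.fill y).isTriple = true}, D.fill y.1 = .split (m y.1) := by
  have hs (y : Y) (h : ¬ (D.fill y).isTriple = true) :
      D.fill y = .split ((D.resolve ρ).fill ⟨y, Bool.eq_false_of_not_eq_true h⟩) := by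
    simp only [resolve]
    split
    assumption
  constructor
  · rintro rfl
    refine ⟨fun y => ?_, fun y => ?_⟩
    · rw [localFill, dif_pos y.2]
    · rw [localFill, dif_neg y.2]
      exact hs y.1 y.2
  · rintro ⟨h1, h2⟩
    funext y
    by_cases h : (D.fill y).isTriple = true
    · rw [localFill, dif_pos h]
      exact h1 ⟨y, h⟩
    · rw [localFill, dif_neg h]
      exact Content.split.inj ((hs y h).symm.trans (h2 ⟨y, h⟩))

/-- The contribution of the resolved triple crossings to the coefficient of the splits `m`. -/
theorem sum_localFill_eq [Fintype Y] [DecidableEq Y] (D : Diagram X Y Content) (ρ : Y → Fin 2)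
    (m : Y → Split) :
    (∑ k : D.Triples → Fin 3 → Bool, if D.localFill ρ (fun z => k z.1 z.2) = m then
      ∏ y, LaurentPolynomial.T (∑ c, if k y c = true then 1 else -1) *
        (if hasLoop (connects (resolvedOver ((D.fill y.1).height y.2) (ρ y.1)) (k y)) = true
          then loopValue else 1) else 0) =
      ∏ y, contentCoeff (ρ y) (D.fill y) (m y) := by
  classical
  rw [← Fintype.prod_subtype_mul_prod_subtype (fun y => (D.fill y).isTriple = true)]
  simp only [fun y : D.Triples => contentCoeff_of_isTriple (ρ y.1) _ y.2 (m y.1),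
    fun y : {y : Y // ¬ (D.fill y).isTriple = true} =>
      contentCoeff_of_not_isTriple (ρ y.1) _ y.2 (m y.1), Fintype.prod_boole, crossingsCoeff]
  -- A product over triple crossings of sums over local smoothings is a sum over all smoothings of
  -- products; the discs already split contribute Kronecker deltas.
  rw [Fintype.prod_sum, Finset.sum_mul]
  refine Finset.sum_congr rfl fun k _ => ?_
  rw [Finset.prod_ite_zero]
  have hiff := D.localFill_eq_iff ρ (fun z => k z.1 z.2) m
  by_cases h : D.localFill ρ (fun z => k z.1 z.2) = m
  · obtain ⟨h1, h2⟩ := hiff.1 h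
    rw [if_pos h, if_pos fun y _ => h1 y, if_pos h2, mul_one]
  · rw [if_neg h]
    rw [hiff, not_and_or] at h
    rcases h with h | h
    · rw [if_neg fun h' => h fun y => h' y (Finset.mem_univ y), zero_mul]
    · rw [if_neg h, mul_zero]

variable [Fintype X] [Fintype Y]

/-- The term of the bracket of `D` that belongs to the state `s` of the double crossings and the
splits `m`, up to the coefficients of the six-ended discs. -/
noncomputable def term {F : Type*} (D : Diagram X Y F) (s : X → Bool) (m : Y → Split) :
    LaurentPolynomial ℤ :=
  LaurentPolynomial.T (∑ x, if s x = true then 1 else -1) *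
    loopValue ^ ((D.withFill m).stateCircles s - 1)

theorem stateCircles_pos (D : Diagram X Y Split) (s : X → Bool) (y : Y) :
    0 < D.stateCircles s := by
  have : Nonempty (D.Curves s) := ⟨Quot.mk _ (.inr (y, 0))⟩
  exact Nat.add_pos_left Nat.card_pos _

theorem loopValue_pow_stateCircles (D : Diagram X Y Content) (ρ : Y → Fin 2)
    (s : X ⊕ D.Triples × Fin 3 → Bool) :
    loopValue ^ ((D.resolve ρ).stateCircles s - 1) =
      loopValue ^ ((D.smoothed ρ s).stateCircles (fun x => s (.inl x)) - 1) *
        ∏ y, if hasLoop (D.smoothings ρ s y) = true then loopValue else 1 := by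
  rw [stateCircles_resolve, Finset.prod_ite, Finset.prod_const, Finset.prod_const_one, mul_one,
    ← Fintype.card_subtype, ← Nat.card_eq_fintype_card, ← pow_add]
  congr 1
  -- The truncated subtraction in `|s| - 1` matters only when there is a loop; its disc then has
  -- boundary ends, so the smoothed diagram has a curve too.
  rcases isEmpty_or_nonempty (D.Loops ρ s) with h | ⟨⟨y, hy⟩⟩
  · rw [Nat.card_of_isEmpty]; rfl
  · exact Nat.sub_add_comm (stateCircles_pos _ _ y.1)

/-- The expansion of the bracket at all six-ended discs. -/
theorem bracket_eq_sum [DecidableEq X] [DecidableEq Y] (D : Diagram X Y Content) (ρ : Y → Fin 2) :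
    D.bracket ρ =
      ∑ s : X → Bool, ∑ m : Y → Split,
        (∏ y, contentCoeff (ρ y) (D.fill y) (m y)) * D.term s m := by
  rw [bracket, stateSum, ← (Equiv.sumArrowEquivProdArrow X (D.Triples × Fin 3) Bool).symm.sum_comp,
    Fintype.sum_prod_type]
  refine Finset.sum_congr rfl fun s _ => ?_
  -- Currying groups the smoothings by triple crossing, as `sum_localFill_eq` requires.
  rw [← (Equiv.curry D.Triples (Fin 3) Bool).symm.sum_comp]
  simp only [← sum_localFill_eq, Finset.sum_mul]
  rw [Finset.sum_comm]
  refine Finset.sum_congr rfl fun k _ => ?_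
  -- For fixed smoothings only the splits they produce, `localFill`, survive in the sum over `m`.
  simp only [ite_mul, zero_mul, Finset.sum_ite_eq, Finset.mem_univ, if_true]
  rw [← loopValue, loopValue_pow_stateCircles, Fintype.sum_sum_type, Fintype.sum_prod_type,
    LaurentPolynomial.T_add, Finset.prod_mul_distrib, term]
  have hT {ι : Type _} (t : Finset ι) (f : ι → ℤ) :
      (LaurentPolynomial.T (∑ i ∈ t, f i) : LaurentPolynomial ℤ) =
        ∏ i ∈ t, LaurentPolynomial.T (f i) := by
    classical
    induction t using Finset.induction_on with
    | empty => simp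
    | insert a t ha ih =>
      rw [Finset.sum_insert ha, Finset.prod_insert ha, LaurentPolynomial.T_add, ih]
  -- Only the sum over triple crossings becomes a product; the exponent at each one stays a sum.
  rw [hT Finset.univ fun y : D.Triples => _]
  exact (fun a b c d => by ring : ∀ a b c d : LaurentPolynomial ℤ,
    a * b * (c * d) = b * d * (a * c)) _ _ _ _

/-- The expansion of the bracket at all six-ended discs, with the coefficient of one of them
separated. -/
theorem bracket_eq_sum_mul [DecidableEq X] [DecidableEq Y] (D : Diagram X Y Content)
    (ρ : Y → Fin 2) (y : Y) :
    D.bracket ρ =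
      ∑ s : X → Bool, ∑ m : Y → Split, contentCoeff (ρ y) (D.fill y) (m y) *
        ((∏ z ∈ {y}ᶜ, contentCoeff (ρ z) (D.fill z) (m z)) * D.term s m) := by
  rw [bracket_eq_sum]
  simp only [Fintype.prod_eq_mul_prod_compl y, mul_assoc]

/-- Splitting at `y` only replaces the coefficient there by a Kronecker delta: `term` ignores the
contents of the discs, and the other coefficients are unchanged. The skein relation is therefore
linear in the coefficient at `y`. -/
theorem bracket_splitAt [DecidableEq X] [DecidableEq Y] (D : Diagram X Y Content)
    (ρ : Y → Fin 2) (y : Y) (m' : Split) :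
    (D.splitAt y m').bracket ρ =
      ∑ s : X → Bool, ∑ m : Y → Split, (if m' = m y then 1 else 0) *
        ((∏ z ∈ {y}ᶜ, contentCoeff (ρ z) (D.fill z) (m z)) * D.term s m) := by
  rw [bracket_eq_sum_mul _ ρ y]
  refine Finset.sum_congr rfl fun s _ => Finset.sum_congr rfl fun m _ => ?_
  congr 1
  · simp [splitAt, contentCoeff]
  · congr 1
    refine Finset.prod_congr rfl fun z hz => ?_
    have : z ≠ y := by simpa using hz
    simp [splitAt, this]

theorem bracket_eq_of_contentCoeff [DecidableEq X] [DecidableEq Y] (D : Diagram X Y Content)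
    (ρ : Y → Fin 2) (y : Y) (h : Equiv.Perm (Fin 3)) (q : ℤ)
    (hc : ∀ m, contentCoeff (ρ y) (D.fill y) m = skeinCoeff q h m) :
    D.bracket ρ =
      LaurentPolynomial.T (3 * q) * (D.splitAt y (splitM h)).bracket ρ +
      LaurentPolynomial.T q *
        ((D.splitAt y (.uturns 0)).bracket ρ + (D.splitAt y (.uturns 1)).bracket ρ) +
      LaurentPolynomial.T (-q) *
        ((D.splitAt y (splitB h)).bracket ρ + (D.splitAt y (splitT h)).bracket ρ) := by
  rw [bracket_eq_sum_mul D ρ y]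
  simp only [bracket_splitAt, Finset.mul_sum, ← Finset.sum_add_distrib, hc, skeinCoeff]
  refine Finset.sum_congr rfl fun s _ => Finset.sum_congr rfl fun m _ => ?_
  ring

end Diagram

end TripleCrossing

theorem theorem3p1 {X Y : Type*} [Fintype X] [DecidableEq X] [Fintype Y] [DecidableEq Y]
    (D : TripleCrossing.Diagram X Y TripleCrossing.Content) :
    -- the bracket does not depend on how the triple crossings are resolved
    (∀ ρ ρ' : Y → Fin 2, D.bracket ρ = D.bracket ρ') ∧
    -- the skein relations at a triple crossing `y`
    ∀ (ρ : Y → Fin 2) (y : Y) (height : Equiv.Perm (Fin 3)), D.fill y = .triple height →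
      (TripleCrossing.IsBMT height →
        D.bracket ρ =
          LaurentPolynomial.T 3 * (D.splitAt y (TripleCrossing.splitM height)).bracket ρ +
          LaurentPolynomial.T 1 *
            ((D.splitAt y (.uturns 0)).bracket ρ + (D.splitAt y (.uturns 1)).bracket ρ) +
          LaurentPolynomial.T (-1) *
            ((D.splitAt y (TripleCrossing.splitB height)).bracket ρ +
              (D.splitAt y (TripleCrossing.splitT height)).bracket ρ)) ∧
      (TripleCrossing.IsTMB height →
        D.bracket ρ =
          LaurentPolynomial.T (-3) * (D.splitAt y (TripleCrossing.splitM height)).bracket ρ +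
          LaurentPolynomial.T (-1) *
            ((D.splitAt y (.uturns 0)).bracket ρ + (D.splitAt y (.uturns 1)).bracket ρ) +
          LaurentPolynomial.T 1 *
            ((D.splitAt y (TripleCrossing.splitB height)).bracket ρ +
              (D.splitAt y (TripleCrossing.splitT height)).bracket ρ)) := by
  refine ⟨fun ρ ρ' => ?_, fun ρ y height hy => ⟨fun h => ?_, fun h => ?_⟩⟩
  · rw [D.bracket_eq_sum ρ, D.bracket_eq_sum ρ']
    simp only [fun y m => TripleCrossing.contentCoeff_eq (ρ y) (ρ' y) (D.fill y) m]
  · have := D.bracket_eq_of_contentCoeff ρ y height 1 fun m => by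
      rw [hy]
      exact TripleCrossing.crossingsCoeff_of_isBMT _ h m
    rwa [mul_one] at this
  · have := D.bracket_eq_of_contentCoeff ρ y height (-1) fun m => by
      rw [hy]
      exact TripleCrossing.crossingsCoeff_of_isTMB _ h m
    rwa [neg_neg, mul_neg_one] at this
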